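/- Let $G$ be a (discrete) group and let $I$ be an arbitrary nonempty set, finite or infinite. Let $S=B(I,G)$ be the Brandt semigroup over $G$ with index set $I$, that is, $S=(I\times G\times I)\cup\{o\}$ with $(i,g,j)(i',g',j')=(i,gg',j')$ if $j=i'$ and $(i,g,j)(i',g',j')=o$ if $j\ne i'$, where $o$ is a null element ($os=so=o$ for all $s\in S$). Let $\ell^1(S)$ be the Banach algebra of absolutely summable functions $S\to\mathbb{C}$ with the convolution product $(ab)(s)=\sum_{xy=s}a(x)b(y)$. **Theorem.** If $G$ is amenable (i.e. there is a left invariant mean on $\ell^\infty(G)$), then $\ell^1(S)$ is pseudo-amenable. Here a Banach algebra $A$ is called pseudo-amenable if there is a net $(n_\lambda)$ (not necessarily bounded) in the completed projective tensor product $A\hat\otimes A$, called an approximate diagonal, such that for every $a\in A$ one has $a\cdot n_\lambda-n_\lambda\cdot a\to 0$ and $\pi(n_\lambda)a\to a$ in norm, where $a\cdot(b\otimes c)=ab\otimes c$, $(b\otimes c)\cdot a=b\otimes ca$, and $\pi:A\hat\otimes A\to A$ is the continuous linear map with $\pi(b\otimes c)=bc$. -/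

import Mathlib

open scoped ENNReal Topology TensorProduct
open Filter

universe u v

/-! ### Amenable discrete groups -/

/-- A discrete group `G` is amenable if there is a left invariant mean on the space `ℓ^∞(G)` of
bounded real functions: a positive linear functional `m` with `m 1 = 1` such that `m f' = m f`
whenever `f'` is the left translate `x ↦ f (g * x)` of `f`. -/
def IsAmenableGroup (G : Type v) [Group G] : Prop :=
  ∃ m : lp (fun _ : G => ℝ) ∞ →ₗ[ℝ] ℝ,
    m 1 = 1 ∧
    (∀ f : lp (fun _ : G => ℝ) ∞, (∀ x, 0 ≤ f x) → 0 ≤ m f) ∧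
    ∀ (g : G) (f f' : lp (fun _ : G => ℝ) ∞), (∀ x, f' x = f (g * x)) → m f' = m f

/-! ### Brandt semigroups -/

/-- The underlying set of the Brandt semigroup `B(I, G)`: the triples `(i, g, j)` in `I × G × I`
together with a null element. -/
inductive BrandtSemigroup (I : Type u) (G : Type v) : Type (max u v)
  | null : BrandtSemigroup I G
  | elem (i : I) (g : G) (j : I) : BrandtSemigroup I G

namespace BrandtSemigroup

variable {I : Type u} {G : Type v}

open Classical in
/-- `(i, g, j) (i', g', j') = (i, g g', j')` if `j = i'`; all other products are the null
element. -/
protected noncomputable def mul [Mul G] : BrandtSemigroup I G → BrandtSemigroup I G →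
    BrandtSemigroup I G
  | elem i g j, elem i' g' j' => if j = i' then elem i (g * g') j' else null
  | _, _ => null

noncomputable instance [Mul G] : Mul (BrandtSemigroup I G) := ⟨BrandtSemigroup.mul⟩

open Classical in
theorem elem_mul_elem [Mul G] (i j i' j' : I) (g g' : G) :
    (elem i g j * elem i' g' j' : BrandtSemigroup I G) =
      if j = i' then elem i (g * g') j' else null := rfl

@[simp] theorem null_mul [Mul G] (x : BrandtSemigroup I G) : null * x = null := rfl

@[simp] theorem mul_null [Mul G] (x : BrandtSemigroup I G) : x * null = null := by
  cases x <;> rfl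

noncomputable instance [Group G] : Semigroup (BrandtSemigroup I G) where
  mul_assoc x y z := by
    rcases x with _ | ⟨i, g, j⟩
    · simp
    rcases y with _ | ⟨k, h, l⟩
    · simp
    rcases z with _ | ⟨m, p, n⟩
    · simp
    by_cases h₁ : j = k <;> by_cases h₂ : l = m <;> simp [elem_mul_elem, h₁, h₂, mul_assoc]

end BrandtSemigroup

/-! ### The Banach algebra `ℓ¹(S)` of a discrete semigroup -/

/-- The Banach space `ℓ¹(S)` of absolutely summable complex functions on `S`; it carries the
convolution product defined below. -/
def L1Algebra (S : Type u) : Type u := lp (fun _ : S => ℂ) 1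

namespace L1Algebra

section Space

variable {S : Type u}

noncomputable instance : NormedAddCommGroup (L1Algebra S) :=
  inferInstanceAs (NormedAddCommGroup (lp (fun _ : S => ℂ) 1))

noncomputable instance : NormedSpace ℂ (L1Algebra S) :=
  inferInstanceAs (NormedSpace ℂ (lp (fun _ : S => ℂ) 1))

instance : CompleteSpace (L1Algebra S) :=
  inferInstanceAs (CompleteSpace (lp (fun _ : S => ℂ) 1))

instance : FunLike (L1Algebra S) S ℂ where
  coe a := (show lp (fun _ : S => ℂ) 1 from a)
  coe_injective _ _ h := lp.ext h

theorem ext {a b : L1Algebra S} (h : ∀ s, a s = b s) : a = b := DFunLike.ext a b h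

@[simp] theorem add_apply (a b : L1Algebra S) (s : S) : (a + b) s = a s + b s := rfl
@[simp] theorem zero_apply (s : S) : (0 : L1Algebra S) s = 0 := rfl
@[simp] theorem smul_apply (c : ℂ) (a : L1Algebra S) (s : S) : (c • a) s = c * a s := rfl

theorem summable_norm (a : L1Algebra S) : Summable fun s => ‖a s‖ := by
  have h := (lp.memℓp (show lp (fun _ : S => ℂ) 1 from a)).summable (by simp)
  simp only [ENNReal.toReal_one, Real.rpow_one] at h
  exact h

theorem norm_eq_tsum (a : L1Algebra S) : ‖a‖ = ∑' s, ‖a s‖ := by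
  have h := lp.norm_eq_tsum_rpow (p := 1) (by simp) (show lp (fun _ : S => ℂ) 1 from a)
  simp only [ENNReal.toReal_one, Real.rpow_one, div_one] at h
  exact h

/-- The element of `ℓ¹(S)` given by an absolutely summable function. -/
def ofSummable (f : S → ℂ) (hf : Summable fun s => ‖f s‖) : L1Algebra S :=
  ⟨f, memℓp_gen (by simpa using hf)⟩

@[simp] theorem ofSummable_apply (f : S → ℂ) (hf : Summable fun s => ‖f s‖) (s : S) :
    ofSummable f hf s = f s := rfl

end Space

section Convolution

variable {S : Type u}

theorem norm_ite_le (P : Prop) [Decidable P] (z : ℂ) : ‖if P then z else 0‖ ≤ ‖z‖ := by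
  split_ifs
  · exact le_rfl
  · rw [norm_zero]
    exact norm_nonneg _

theorem summable_norm_prod (a b : L1Algebra S) :
    Summable fun p : S × S => ‖a p.1 * b p.2‖ := by
  simpa using a.summable_norm.mul_of_nonneg b.summable_norm
    (fun _ => norm_nonneg _) (fun _ => norm_nonneg _)

variable [Semigroup S]

/-- The convolution `(a * b)(s) = ∑_{xy = s} a(x) b(y)`. -/
noncomputable def conv (a b : S → ℂ) (s : S) : ℂ :=
  ∑' p : {p : S × S // p.1 * p.2 = s}, a p.1.1 * b p.1.2

theorem summable_norm_sigma (a b : L1Algebra S) :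
    Summable fun q : (s : S) × {p : S × S // p.1 * p.2 = s} => ‖a q.2.1.1 * b q.2.1.2‖ :=
  ((Equiv.sigmaFiberEquiv fun p : S × S => p.1 * p.2).summable_iff
    (f := fun p : S × S => ‖a p.1 * b p.2‖)).2 (summable_norm_prod a b)

theorem norm_conv_le (a b : L1Algebra S) (s : S) :
    ‖conv a b s‖ ≤ ∑' p : {p : S × S // p.1 * p.2 = s}, ‖a p.1.1 * b p.1.2‖ :=
  norm_tsum_le_tsum_norm ((summable_norm_sigma a b).sigma_factor s)

theorem summable_norm_conv (a b : L1Algebra S) : Summable fun s => ‖conv a b s‖ :=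
  Summable.of_nonneg_of_le (fun _ => norm_nonneg _) (norm_conv_le a b) (summable_norm_sigma a b).sigma

noncomputable instance : Mul (L1Algebra S) :=
  ⟨fun a b => ofSummable (conv a b) (summable_norm_conv a b)⟩

theorem mul_apply (a b : L1Algebra S) (s : S) :
    (a * b) s = ∑' p : {p : S × S // p.1 * p.2 = s}, a p.1.1 * b p.1.2 := rfl

theorem norm_mul_le' (a b : L1Algebra S) : ‖a * b‖ ≤ ‖a‖ * ‖b‖ := by
  rw [norm_eq_tsum, norm_eq_tsum, norm_eq_tsum]
  have h1 : ∑' s, ‖(a * b) s‖ ≤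
      ∑' s, ∑' p : {p : S × S // p.1 * p.2 = s}, ‖a p.1.1 * b p.1.2‖ :=
    (summable_norm_conv a b).tsum_le_tsum (norm_conv_le a b) (summable_norm_sigma a b).sigma
  refine h1.trans (le_of_eq ?_)
  rw [← (summable_norm_sigma a b).tsum_sigma]
  refine ((Equiv.sigmaFiberEquiv fun p : S × S => p.1 * p.2).tsum_eq
      (fun p : S × S => ‖a p.1 * b p.2‖)).trans ?_
  rw [a.summable_norm.tsum_mul_tsum b.summable_norm (by simpa using summable_norm_prod a b)]
  simp

theorem summable_fiber (a b : L1Algebra S) (s : S) :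
    Summable fun p : {p : S × S // p.1 * p.2 = s} => a p.1.1 * b p.1.2 :=
  ((summable_norm_sigma a b).sigma_factor s).of_norm

/-- Integrating a bounded function against a convolution. -/
theorem tsum_mul_conv (φ : S → ℂ) (hφ : ∀ s, ‖φ s‖ ≤ 1) (a b : L1Algebra S) :
    ∑' s, φ s * (a * b) s = ∑' p : S × S, φ (p.1 * p.2) * (a p.1 * b p.2) := by
  have hs : Summable fun p : S × S => φ (p.1 * p.2) * (a p.1 * b p.2) := by
    refine Summable.of_norm_bounded (summable_norm_prod a b) fun p => ?_
    rw [norm_mul]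
    exact mul_le_of_le_one_left (norm_nonneg _) (hφ _)
  let e := Equiv.sigmaFiberEquiv fun p : S × S => p.1 * p.2
  rw [← e.tsum_eq, Summable.tsum_sigma (f := fun q => φ ((e q).1 * (e q).2) *
    (a (e q).1 * b (e q).2)) (e.summable_iff.2 hs)]
  refine tsum_congr fun s => ?_
  rw [mul_apply, ← tsum_mul_left]
  refine tsum_congr fun p => ?_
  change φ s * _ = φ (p.1.1 * p.1.2) * _
  rw [p.2]
  rfl

open Classical in
theorem mul_apply_eq_tsum_ite (a b : L1Algebra S) (s : S) :
    (a * b) s = ∑' p : S × S, if p.1 * p.2 = s then a p.1 * b p.2 else 0 := by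
  rw [mul_apply]
  exact (tsum_subtype {p : S × S | p.1 * p.2 = s} fun p => a p.1 * b p.2).trans
    (tsum_congr fun p => by simp [Set.indicator_apply])

open Classical in
theorem mul_mul_apply_left (a b c : L1Algebra S) (s : S) :
    ((a * b) * c) s =
      ∑' q : (S × S) × S, if q.1.1 * q.1.2 * q.2 = s then a q.1.1 * b q.1.2 * c q.2 else 0 := by
  have hn : Summable fun q : (S × S) × S => ‖(a q.1.1 * b q.1.2) * c q.2‖ := by
    simpa using (summable_norm_prod a b).mul_of_nonneg c.summable_norm
      (fun _ => norm_nonneg _) (fun _ => norm_nonneg _)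
  have hs : Summable fun q : (S × S) × S =>
      if q.1.1 * q.1.2 * q.2 = s then a q.1.1 * b q.1.2 * c q.2 else 0 :=
    Summable.of_norm_bounded hn fun q => norm_ite_le _ _
  have hs' : Summable fun p : S × S => if p.1 * p.2 = s then (a * b) p.1 * c p.2 else 0 :=
    Summable.of_norm_bounded (summable_norm_prod (a * b) c) fun q => norm_ite_le _ _
  rw [mul_apply_eq_tsum_ite]
  refine ((Equiv.prodComm S S).tsum_eq _).symm.trans
    (Eq.trans ?_ ((Equiv.prodComm S (S × S)).tsum_eq _))
  refine (((Equiv.prodComm S S).summable_iff.2 hs').tsum_prod).trans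
    (Eq.trans ?_ (((Equiv.prodComm S (S × S)).summable_iff.2 hs).tsum_prod).symm)
  refine tsum_congr fun z => ?_
  have h := tsum_mul_conv (fun x => if x * z = s then 1 else 0)
    (fun x => by split_ifs <;> simp) a b
  have h' := congrArg (· * c z) h
  simp only [← tsum_mul_right] at h'
  refine Eq.trans (tsum_congr fun x => ?_) (h'.trans (tsum_congr fun p => ?_)) <;>
    simp

open Classical in
theorem mul_mul_apply_right (a b c : L1Algebra S) (s : S) :
    (a * (b * c)) s =
      ∑' q : S × (S × S), if q.1 * (q.2.1 * q.2.2) = s then a q.1 * (b q.2.1 * c q.2.2) else 0 := by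
  have hn : Summable fun q : S × (S × S) => ‖a q.1 * (b q.2.1 * c q.2.2)‖ := by
    simpa using a.summable_norm.mul_of_nonneg (summable_norm_prod b c)
      (fun _ => norm_nonneg _) (fun _ => norm_nonneg _)
  have hs : Summable fun q : S × (S × S) =>
      if q.1 * (q.2.1 * q.2.2) = s then a q.1 * (b q.2.1 * c q.2.2) else 0 :=
    Summable.of_norm_bounded hn fun q => norm_ite_le _ _
  have hs' : Summable fun p : S × S => if p.1 * p.2 = s then a p.1 * (b * c) p.2 else 0 :=
    Summable.of_norm_bounded (summable_norm_prod a (b * c)) fun q => norm_ite_le _ _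
  rw [mul_apply_eq_tsum_ite, hs'.tsum_prod, hs.tsum_prod]
  refine tsum_congr fun x => ?_
  have h := tsum_mul_conv (fun y => if x * y = s then 1 else 0)
    (fun x => by split_ifs <;> simp) b c
  have h' := congrArg (a x * ·) h
  simp only [← tsum_mul_left] at h'
  refine Eq.trans (tsum_congr fun x => ?_) (h'.trans (tsum_congr fun p => ?_)) <;>
    simp

noncomputable instance : NonUnitalNormedRing (L1Algebra S) :=
  { (inferInstance : NormedAddCommGroup (L1Algebra S)),
    (inferInstance : Mul (L1Algebra S)) with
    left_distrib := fun a b c => ext fun s => by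
      simp only [mul_apply, add_apply, mul_add]
      exact (summable_fiber a b s).tsum_add (summable_fiber a c s)
    right_distrib := fun a b c => ext fun s => by
      simp only [mul_apply, add_apply, add_mul]
      exact (summable_fiber a c s).tsum_add (summable_fiber b c s)
    zero_mul := fun a => ext fun s => by simp [mul_apply]
    mul_zero := fun a => ext fun s => by simp [mul_apply]
    mul_assoc := fun a b c => ext fun s => by
      rw [mul_mul_apply_left, mul_mul_apply_right]
      refine Eq.trans (tsum_congr fun q => ?_) ((Equiv.prodAssoc S S S).tsum_eq _)
      obtain ⟨⟨x, y⟩, z⟩ := q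
      classical
      exact if_congr (by rw [mul_assoc]; exact Iff.rfl) (mul_assoc _ _ _) rfl
    norm_mul_le := norm_mul_le' }

instance : IsScalarTower ℂ (L1Algebra S) (L1Algebra S) :=
  ⟨fun c a b => ext fun s => by
    simp only [smul_eq_mul, mul_apply, smul_apply, mul_assoc, tsum_mul_left]⟩

instance : SMulCommClass ℂ (L1Algebra S) (L1Algebra S) :=
  ⟨fun c a b => ext fun s => by
    simp only [smul_eq_mul, mul_apply, smul_apply, mul_left_comm _ c, tsum_mul_left]⟩

end Convolution

end L1Algebra

/-! ### The completed projective tensor square and pseudo-amenability -/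

/-- The completed projective tensor product `A ⊗̂ A`: the completion of the algebraic tensor
product `A ⊗ A` with respect to the projective seminorm. -/
abbrev ProjTensorSq (A : Type u) [NormedAddCommGroup A] [NormedSpace ℂ A] : Type u :=
  UniformSpace.Completion (⨂[ℂ] _ : Fin 2, A)

namespace ProjTensorSq

section Basic

variable {A : Type u} [NormedAddCommGroup A] [NormedSpace ℂ A]

/-- The elementary tensor `a ⊗ b` in `A ⊗̂ A`. -/
noncomputable def tmul (a b : A) : ProjTensorSq A :=
  ((PiTensorProduct.tprod ℂ ![a, b] : ⨂[ℂ] _ : Fin 2, A) : ProjTensorSq A)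

variable {E : Type*} [NormedAddCommGroup E] [NormedSpace ℂ E] [CompleteSpace E]

/-- The continuous linear extension to `A ⊗̂ A` of a continuous linear map on `A ⊗ A`. -/
noncomputable def extend (f : (⨂[ℂ] _ : Fin 2, A) →L[ℂ] E) : ProjTensorSq A →L[ℂ] E :=
  f.extend (UniformSpace.Completion.toComplL (𝕜 := ℂ) (E := ⨂[ℂ] _ : Fin 2, A))

theorem extend_coe (f : (⨂[ℂ] _ : Fin 2, A) →L[ℂ] E) (x : ⨂[ℂ] _ : Fin 2, A) :
    extend f (x : ProjTensorSq A) = f x :=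
  f.extend_eq (e := UniformSpace.Completion.toComplL (𝕜 := ℂ) (E := ⨂[ℂ] _ : Fin 2, A))
    UniformSpace.Completion.denseRange_coe
    (UniformSpace.Completion.isUniformInducing_coe _) x

/-- The continuous linear map `A ⊗̂ A → A ⊗̂ A` with `a ⊗ b ↦ f a ⊗ g b`. -/
noncomputable def map (f g : A →L[ℂ] A) : ProjTensorSq A →L[ℂ] ProjTensorSq A :=
  extend ((UniformSpace.Completion.toComplL (𝕜 := ℂ) (E := ⨂[ℂ] _ : Fin 2, A)).comp
    (PiTensorProduct.mapL (E := fun _ : Fin 2 => A) (E' := fun _ : Fin 2 => A) ![f, g]))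

theorem map_tmul (f g : A →L[ℂ] A) (a b : A) : map f g (tmul a b) = tmul (f a) (g b) := by
  unfold map tmul
  rw [extend_coe]
  simp only [ContinuousLinearMap.comp_apply, PiTensorProduct.mapL_apply, PiTensorProduct.map_tprod]
  change ((_ : ⨂[ℂ] _ : Fin 2, A) : ProjTensorSq A) = _
  congr 2
  ext i
  fin_cases i <;> rfl

end Basic

section Algebra

variable {A : Type u} [NonUnitalNormedRing A] [NormedSpace ℂ A] [IsScalarTower ℂ A A]
  [SMulCommClass ℂ A A]

/-- The left module action `a · (b ⊗ c) = ab ⊗ c`. -/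
noncomputable def leftAct (a : A) : ProjTensorSq A →L[ℂ] ProjTensorSq A :=
  map (ContinuousLinearMap.mul ℂ A a) (ContinuousLinearMap.id ℂ A)

/-- The right module action `(b ⊗ c) · a = b ⊗ ca`. -/
noncomputable def rightAct (a : A) : ProjTensorSq A →L[ℂ] ProjTensorSq A :=
  map (ContinuousLinearMap.id ℂ A) ((ContinuousLinearMap.mul ℂ A).flip a)

theorem leftAct_tmul (a b c : A) : leftAct a (tmul b c) = tmul (a * b) c := by
  simp [leftAct, map_tmul]

theorem rightAct_tmul (a b c : A) : rightAct a (tmul b c) = tmul b (c * a) := by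
  simp [rightAct, map_tmul]

/-- The multiplication of `A` as a continuous multilinear map in two variables. -/
noncomputable def mulMultilinear : ContinuousMultilinearMap ℂ (fun _ : Fin 2 => A) A where
  toFun v := v 0 * v 1
  map_update_add' v i x y := by fin_cases i <;> simp [add_mul, mul_add]
  map_update_smul' v i c x := by fin_cases i <;> simp [smul_mul_assoc, mul_smul_comm]
  cont := by fun_prop

variable [CompleteSpace A]

/-- The diagonal map `π : A ⊗̂ A → A`, `π (a ⊗ b) = ab`. -/
noncomputable def diagonalMap : ProjTensorSq A →L[ℂ] A :=
  extend (PiTensorProduct.liftIsometry ℂ (fun _ : Fin 2 => A) A mulMultilinear)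

theorem diagonalMap_tmul (a b : A) : diagonalMap (tmul a b) = a * b := by
  unfold diagonalMap tmul
  rw [extend_coe]
  simp [mulMultilinear]

end Algebra

end ProjTensorSq

/-- A net `n` in `A ⊗̂ A`, indexed by a directed set `Λ`, is a (possibly unbounded) approximate
diagonal for `A` if `a · n_l - n_l · a → 0` and `π(n_l) a → a` for every `a` in `A`. -/
def IsApproximateDiagonal {A : Type u} [NonUnitalNormedRing A] [NormedSpace ℂ A]
    [IsScalarTower ℂ A A] [SMulCommClass ℂ A A] [CompleteSpace A]
    {Λ : Type v} [Preorder Λ] (n : Λ → ProjTensorSq A) : Prop :=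
  ∀ a : A,
    Tendsto (fun l => ProjTensorSq.leftAct a (n l) - ProjTensorSq.rightAct a (n l)) atTop (𝓝 0) ∧
    Tendsto (fun l => ProjTensorSq.diagonalMap (n l) * a) atTop (𝓝 a)

/-- A Banach algebra is pseudo-amenable if it has an approximate diagonal, that is, one indexed by
some nonempty directed set. -/
def IsPseudoAmenable (A : Type u) [NonUnitalNormedRing A] [NormedSpace ℂ A]
    [IsScalarTower ℂ A A] [SMulCommClass ℂ A A] [CompleteSpace A] : Prop :=
  ∃ (Λ : Type u) (_ : Preorder Λ) (_ : IsDirectedOrder Λ) (_ : Nonempty Λ)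
    (n : Λ → ProjTensorSq A), IsApproximateDiagonal n

/-!
Let `S = B(I, G)`, write `δ_s` for the point mass at `s`, and put `e_igj = δ_(i,g,j) - δ_o`. These
elements multiply like the matrix units `g E_ij` over `G` and are annihilated by `δ_o`. For a finite
set `F ⊆ I` and `x ∈ G` consider

  `n_x = δ_o ⊗ δ_o + |F|⁻¹ ∑_{i, j ∈ F} e_{i,x,j} ⊗ e_{j,x⁻¹,i}`.

Then `π(n_x) = δ_o + ∑_{i ∈ F} e_{i,1,i}` fixes `δ_(k,g,l)` as soon as `k ∈ F`, and if `k, l ∈ F`,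
then for `s = (k,g,l)` one has `δ_s · n_x - n_x · δ_s = u_s(g x) - u_s(x)`, where
`u_s(x) = |F|⁻¹ ∑_{j ∈ F} e_{k,x,j} ⊗ e_{j,x⁻¹g,l}` is bounded in `x`. Day's convexity argument, a
separation by a continuous functional followed by an application of the invariant mean
(`IsAmenableGroup.exists_mem_convexHull_norm_lt`), gives a convex combination `n` of the `n_x` for
which finitely many of the differences `δ_s · n - n · δ_s` are small
(`BrandtSemigroup.exists_almost_diagonal`). Carried out directly in the tensor product, the argument
needs neither the duality of `ℓ¹(G)` and `ℓ^∞(G)` nor Følner or Reiter conditions.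

The norms of such `n` are not controlled as `F` grows, but `‖δ_s · n - n · δ_s‖` and
`‖π(n) δ_s - δ_s‖` are bounded uniformly in `s`, `F` and the combination. As every `a` in `ℓ¹(S)` is
`∑ a(s) δ_s`, dominated convergence extends the limits from point masses to all of `ℓ¹(S)`
(`L1Algebra.isPseudoAmenable_of_delta`).

The computations with `n_x` use only the relations of `S` and the bound `‖δ_s‖ ≤ 1`, so they are
made for any homomorphism `d` from `S` into the closed unit ball of a Banach algebra.
-/

/-! ### Point masses in `ℓ¹(S)` -/

namespace L1Algebra

section Delta

variable {S : Type u}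

open Classical in
/-- The point mass at `s`. -/
noncomputable def delta (s : S) : L1Algebra S :=
  show lp (fun _ : S => ℂ) 1 from lp.single 1 s (1 : ℂ)

open Classical in
theorem delta_apply (s t : S) : delta s t = if t = s then 1 else 0 :=
  Pi.single_apply s (1 : ℂ) t

theorem norm_delta (s : S) : ‖delta s‖ = 1 := by
  classical
  rw [norm_eq_tsum, tsum_eq_single s]
  · simp [delta_apply]
  · intro t ht
    simp [delta_apply, ht]

theorem hasSum_smul_delta (a : L1Algebra S) : HasSum (fun s => a s • delta s) a := by
  classical
  have h := lp.hasSum_single (p := 1) ENNReal.one_ne_top (show lp (fun _ : S => ℂ) 1 from a)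
  have e : (fun s => a s • delta s) =
      fun s => lp.single 1 s ((show lp (fun _ : S => ℂ) 1 from a) s) := by
    funext s
    refine ext fun t => ?_
    rw [smul_apply, delta_apply]
    change _ = (Pi.single s (a s) : S → ℂ) t
    by_cases ht : t = s
    · subst ht; simp
    · simp [ht]
  rw [e]
  exact h

theorem delta_mul_delta [Semigroup S] (s t : S) : delta s * delta t = delta (s * t) := by
  classical
  refine ext fun r => ?_
  rw [mul_apply_eq_tsum_ite, tsum_eq_single (s, t)]
  · simp [delta_apply, eq_comm]
  · rintro ⟨x, y⟩ h
    rw [delta_apply, delta_apply]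
    by_cases hx : x = s
    · have hy : y ≠ t := fun hy => h (by rw [hx, hy])
      simp [hy]
    · simp [hx]

/-- The map `s ↦ δ_s`, a homomorphism into the multiplicative semigroup of `ℓ¹(S)`. -/
noncomputable def deltaHom (S : Type u) [Semigroup S] : S →ₙ* L1Algebra S where
  toFun := delta
  map_mul' s t := (delta_mul_delta s t).symm

/-- A net of operators on `ℓ¹(S)` that is uniformly bounded on the point masses and tends to `0`
at each of them tends to `0` at every point. -/
theorem tendsto_zero_of_delta {E : Type*} [NormedAddCommGroup E] [NormedSpace ℂ E]
    [CompleteSpace E]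
    {Λ : Type*} {𝓕 : Filter Λ} (Φ : Λ → L1Algebra S →L[ℂ] E) (C : ℝ)
    (hC : ∀ l s, ‖Φ l (delta s)‖ ≤ C) (h : ∀ s, Tendsto (fun l => Φ l (delta s)) 𝓕 (𝓝 0))
    (a : L1Algebra S) : Tendsto (fun l => Φ l a) 𝓕 (𝓝 0) := by
  have e : ∀ l, Φ l a = ∑' s, a s • Φ l (delta s) := fun l => by
    have h := (Φ l).hasSum (hasSum_smul_delta a)
    simpa using h.tsum_eq.symm
  simp only [e]
  have key := tendsto_tsum_of_dominated_convergence (𝓕 := 𝓕)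
    (f := fun l s => a s • Φ l (delta s)) (g := fun _ => (0 : E)) (bound := fun s => ‖a s‖ * C)
    (a.summable_norm.mul_right C) (fun s => by simpa using (h s).const_smul (a s))
    (Eventually.of_forall fun l s => by
      rw [norm_smul]
      exact mul_le_mul_of_nonneg_left (hC l s) (norm_nonneg _))
  simpa using key

end Delta

end L1Algebra

/-! ### Norm estimates in the projective tensor square -/

namespace ProjTensorSq

theorem update_zero_pair {A : Type*} (a b c : A) : Function.update ![a, b] 0 c = ![c, b] := by
  ext i
  fin_cases i <;> rfl

theorem update_one_pair {A : Type*} (a b c : A) : Function.update ![a, b] 1 c = ![a, c] := by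
  ext i
  fin_cases i <;> rfl

section Basic

variable {A : Type u} [NormedAddCommGroup A] [NormedSpace ℂ A]

theorem norm_tmul_le (a b : A) : ‖tmul a b‖ ≤ ‖a‖ * ‖b‖ := by
  unfold tmul
  rw [UniformSpace.Completion.norm_coe]
  simpa [Fin.prod_univ_two] using
    PiTensorProduct.projectiveSeminorm_tprod_le (𝕜 := ℂ) (E := fun _ : Fin 2 => A) ![a, b]

@[simp] theorem zero_tmul (b : A) : tmul 0 b = 0 := by
  simpa using norm_tmul_le 0 b

@[simp] theorem tmul_zero (a : A) : tmul a 0 = 0 := by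
  simpa using norm_tmul_le a 0

theorem add_tmul (a a' b : A) : tmul (a + a') b = tmul a b + tmul a' b := by
  have h := (PiTensorProduct.tprod ℂ (s := fun _ : Fin 2 => A)).map_update_add ![0, b] 0 a a'
  simp only [update_zero_pair] at h
  unfold tmul
  rw [← UniformSpace.Completion.coe_add]
  exact congrArg _ h

theorem tmul_add (a b b' : A) : tmul a (b + b') = tmul a b + tmul a b' := by
  have h := (PiTensorProduct.tprod ℂ (s := fun _ : Fin 2 => A)).map_update_add ![a, 0] 1 b b'
  simp only [update_one_pair] at h
  unfold tmul
  rw [← UniformSpace.Completion.coe_add]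
  exact congrArg _ h

theorem smul_tmul (z : ℂ) (a b : A) : tmul (z • a) b = z • tmul a b := by
  have h := (PiTensorProduct.tprod ℂ (s := fun _ : Fin 2 => A)).map_update_smul ![0, b] 0 z a
  simp only [update_zero_pair] at h
  unfold tmul
  rw [← UniformSpace.Completion.coe_smul]
  exact congrArg _ h

theorem tmul_smul (z : ℂ) (a b : A) : tmul a (z • b) = z • tmul a b := by
  have h := (PiTensorProduct.tprod ℂ (s := fun _ : Fin 2 => A)).map_update_smul ![a, 0] 1 z b
  simp only [update_one_pair] at h
  unfold tmul
  rw [← UniformSpace.Completion.coe_smul]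
  exact congrArg _ h

theorem norm_map_le (f g : A →L[ℂ] A) : ‖map f g‖ ≤ ‖f‖ * ‖g‖ := by
  refine ContinuousLinearMap.opNorm_le_bound _ (by positivity) fun x => ?_
  induction x using UniformSpace.Completion.induction_on with
  | hp => exact isClosed_le (by fun_prop) (by fun_prop)
  | ih x =>
    unfold map
    rw [extend_coe, UniformSpace.Completion.norm_coe]
    refine (UniformSpace.Completion.norm_coe _).le.trans
      ((ContinuousLinearMap.le_opNorm _ x).trans ?_)
    gcongr
    simpa [Fin.prod_univ_two] using
      PiTensorProduct.opNorm_mapL (𝕜 := ℂ) (E := fun _ : Fin 2 => A) (E' := fun _ : Fin 2 => A)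
        (f := ![f, g])

/-- Elementary tensors span a dense subspace of `A ⊗̂ A`. -/
theorem clm_ext {E : Type*} [NormedAddCommGroup E] [NormedSpace ℂ E]
    {f g : ProjTensorSq A →L[ℂ] E} (h : ∀ a b, f (tmul a b) = g (tmul a b)) : f = g := by
  have e : f.toLinearMap ∘ₗ (UniformSpace.Completion.toComplL (𝕜 := ℂ)
        (E := ⨂[ℂ] _ : Fin 2, A)).toLinearMap =
      g.toLinearMap ∘ₗ (UniformSpace.Completion.toComplL (𝕜 := ℂ)
        (E := ⨂[ℂ] _ : Fin 2, A)).toLinearMap := by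
    refine PiTensorProduct.ext (MultilinearMap.ext fun v => ?_)
    have hv : v = ![v 0, v 1] := by
      ext i
      fin_cases i <;> rfl
    rw [hv]
    exact h (v 0) (v 1)
  ext x
  induction x using UniformSpace.Completion.induction_on with
  | hp => exact isClosed_eq f.continuous g.continuous
  | ih x => exact LinearMap.congr_fun e x

end Basic

section Algebra

variable {A : Type u} [NonUnitalNormedRing A] [NormedSpace ℂ A] [IsScalarTower ℂ A A]
  [SMulCommClass ℂ A A]

theorem leftAct_add (a b : A) : leftAct (a + b) = leftAct a + leftAct b :=
  clm_ext fun c d => by simp [leftAct_tmul, add_mul, add_tmul]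

theorem leftAct_smul (z : ℂ) (a : A) : leftAct (z • a) = z • leftAct a :=
  clm_ext fun c d => by simp [leftAct_tmul, smul_mul_assoc, smul_tmul]

theorem rightAct_add (a b : A) : rightAct (a + b) = rightAct a + rightAct b :=
  clm_ext fun c d => by simp [rightAct_tmul, mul_add, tmul_add]

theorem rightAct_smul (z : ℂ) (a : A) : rightAct (z • a) = z • rightAct a :=
  clm_ext fun c d => by simp [rightAct_tmul, mul_smul_comm, tmul_smul]

theorem norm_leftAct_le (a : A) : ‖leftAct a‖ ≤ ‖a‖ :=
  (norm_map_le _ _).trans <| (mul_le_mul (ContinuousLinearMap.opNorm_mul_apply_le ℂ A a)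
    ContinuousLinearMap.norm_id_le (norm_nonneg _) (norm_nonneg _)).trans_eq (mul_one _)

theorem norm_rightAct_le (a : A) : ‖rightAct a‖ ≤ ‖a‖ := by
  have h : ‖(ContinuousLinearMap.mul ℂ A).flip a‖ ≤ ‖a‖ :=
    ContinuousLinearMap.opNorm_le_bound _ (norm_nonneg a) fun b => by
      simpa [mul_comm] using norm_mul_le b a
  exact (norm_map_le _ _).trans <| (mul_le_mul ContinuousLinearMap.norm_id_le h
    (norm_nonneg _) zero_le_one).trans_eq (one_mul _)

/-- The operator `a ↦ a · n - n · a` attached to `n` in `A ⊗̂ A`. -/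
noncomputable def commutator (n : ProjTensorSq A) : A →L[ℂ] ProjTensorSq A :=
  LinearMap.mkContinuous
    { toFun := fun a => leftAct a n - rightAct a n
      map_add' := fun a b => by
        rw [leftAct_add, rightAct_add, add_apply, add_apply]
        abel
      map_smul' := fun c a => by
        rw [leftAct_smul, rightAct_smul, smul_apply, smul_apply,
          RingHom.id_apply, smul_sub] }
    (2 * ‖n‖) fun a => by
      have h₁ := (leftAct a).le_of_opNorm_le (norm_leftAct_le a) n
      have h₂ := (rightAct a).le_of_opNorm_le (norm_rightAct_le a) n
      refine (norm_sub_le _ _).trans ((add_le_add h₁ h₂).trans_eq ?_)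
      ring

theorem leftAct_smul_sum_tmul {ι : Type*} (c : ℂ) (F : Finset ι) (x : A) (a b : ι → A) :
    leftAct x (c • ∑ i ∈ F, tmul (a i) (b i)) = c • ∑ i ∈ F, tmul (x * a i) (b i) := by
  rw [map_smul, map_sum]
  simp only [leftAct_tmul]

theorem rightAct_smul_sum_tmul {ι : Type*} (c : ℂ) (F : Finset ι) (x : A) (a b : ι → A) :
    rightAct x (c • ∑ i ∈ F, tmul (a i) (b i)) = c • ∑ i ∈ F, tmul (a i) (b i * x) := by
  rw [map_smul, map_sum]
  simp only [rightAct_tmul]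

theorem diagonalMap_smul_sum_tmul [CompleteSpace A] {ι : Type*} (c : ℂ) (F : Finset ι)
    (a b : ι → A) :
    diagonalMap (c • ∑ i ∈ F, tmul (a i) (b i)) = c • ∑ i ∈ F, a i * b i := by
  rw [map_smul, map_sum]
  simp only [diagonalMap_tmul]

end Algebra

end ProjTensorSq

/-! ### A criterion for pseudo-amenability of `ℓ¹(S)` -/

namespace L1Algebra

open ProjTensorSq

/-- An approximate diagonal for `ℓ¹(S)` only has to be tested on point masses, provided that its
terms are uniformly bounded there. Such a net need not be bounded in norm. -/
theorem isPseudoAmenable_of_delta {S : Type u} [Semigroup S] (C : ℝ)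
    (h : ∀ (T : Finset S) (ε : ℝ), 0 < ε → ∃ n : ProjTensorSq (L1Algebra S),
      (∀ s, ‖leftAct (delta s) n - rightAct (delta s) n‖ ≤ C) ∧
      (∀ s, ‖diagonalMap n * delta s - delta s‖ ≤ C) ∧
      (∀ s ∈ T, ‖leftAct (delta s) n - rightAct (delta s) n‖ < ε) ∧
      ∀ s ∈ T, diagonalMap n * delta s = delta s) :
    IsPseudoAmenable (L1Algebra S) := by
  classical
  choose n h₁ h₂ h₃ h₄ using fun l : Finset S × ℕ =>
    h l.1 (1 / ((l.2 : ℝ) + 1)) Nat.one_div_pos_of_nat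
  refine ⟨Finset S × ℕ, inferInstance, inferInstance, inferInstance, n, fun a => ⟨?_, ?_⟩⟩
  · refine tendsto_zero_of_delta (fun l => commutator (n l)) C h₁ (fun s => ?_) a
    rw [Metric.tendsto_atTop]
    intro ε hε
    obtain ⟨N, hN⟩ := exists_nat_one_div_lt hε
    refine ⟨({s}, N), fun l hl => ?_⟩
    rw [dist_zero_right]
    refine (h₃ l s (hl.1 (Finset.mem_singleton_self s))).trans (lt_of_le_of_lt ?_ hN)
    exact Nat.one_div_le_one_div hl.2
  · have key := tendsto_zero_of_delta (𝓕 := atTop)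
      (fun l => ContinuousLinearMap.mul ℂ (L1Algebra S) (diagonalMap (n l)) -
        ContinuousLinearMap.id ℂ (L1Algebra S)) C h₂ (fun s => ?_) a
    · simpa using key.add_const a
    · refine tendsto_const_nhds.congr' ?_
      filter_upwards [eventually_ge_atTop (({s}, 0) : Finset S × ℕ)] with l hl
      exact (sub_eq_zero.2 (h₄ l s (hl.1 (Finset.mem_singleton_self s)))).symm

end L1Algebra

/-! ### Almost invariant convex combinations over an amenable group -/

/-- Day's convexity argument, for vector-valued functions on `G`. If `0` were not in the closed
convex hull, a separating functional, composed with the `u i`, would give finitely many bounded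
functions `φ i` on `G` with `∑ i, (φ i (g i * x) - φ i x) ≥ c > 0` for all `x`, which an invariant
mean excludes. -/
theorem IsAmenableGroup.zero_mem_closure_convexHull {G : Type v} [Group G]
    (hG : IsAmenableGroup G) {E : Type*} [NormedAddCommGroup E] [NormedSpace ℝ E]
    {ι : Type*} [Fintype ι] (g : ι → G) (u : ι → G → E) (hu : ∀ i, ∃ C, ∀ x, ‖u i x‖ ≤ C) :
    (0 : ι → E) ∈ closure (convexHull ℝ (Set.range fun x i => u i (g i * x) - u i x)) := by
  classical
  obtain ⟨m, hm_one, hm_nonneg, hm_inv⟩ := hG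
  by_contra h0
  obtain ⟨f, c, hc, hf⟩ := geometric_hahn_banach_point_closed
    (convex_convexHull ℝ (Set.range fun x i => u i (g i * x) - u i x)).closure
    isClosed_closure h0
  rw [map_zero] at hc
  -- The components of `f` on the factors of `ι → E`.
  let F : ι → E →L[ℝ] ℝ := fun i => f.comp (ContinuousLinearMap.single ℝ (fun _ => E) i)
  have hF : ∀ w : ι → E, f w = ∑ i, F i (w i) := fun w => by
    conv_lhs => rw [← Finset.univ_sum_single w, map_sum]
    rfl
  have hmem : ∀ (i : ι) (k : G), Memℓp (fun x => F i (u i (k * x))) ∞ := fun i k => by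
    obtain ⟨C, hC⟩ := hu i
    refine memℓp_infty ⟨‖F i‖ * C, ?_⟩
    rintro _ ⟨x, rfl⟩
    exact (F i).le_opNorm_of_le (hC _)
  let φ : ι → G → lp (fun _ : G => ℝ) ∞ := fun i k => ⟨fun x => F i (u i (k * x)), hmem i k⟩
  have hφ : ∀ i, m (φ i (g i)) = m (φ i 1) := fun i =>
    hm_inv (g i) (φ i 1) (φ i (g i)) fun x => by
      change F i (u i (g i * x)) = F i (u i (1 * (g i * x)))
      rw [one_mul]
  have hpos := hm_nonneg (∑ i, (φ i (g i) - φ i 1) - c • 1) fun x => by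
    have hx := hf _ (subset_closure (subset_convexHull ℝ _ (Set.mem_range_self x)))
    rw [hF] at hx
    have e : (∑ i, (φ i (g i) - φ i 1) - c • 1 : lp (fun _ : G => ℝ) ∞) x =
        ∑ i, F i (u i (g i * x) - u i x) - c := by
      simp only [φ, lp.coeFn_sub, lp.coeFn_smul, lp.coeFn_sum, Pi.sub_apply, Pi.smul_apply,
        Finset.sum_apply, map_sub, one_mul]
      simp
    rw [e]
    linarith
  -- By invariance the mean of the sum of differences is `0`, so positivity gives `0 ≤ -c`.
  rw [map_sub, map_sum, map_smul, hm_one, Finset.sum_eq_zero fun i _ => by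
    rw [map_sub, hφ i, sub_self]] at hpos
  simp only [smul_eq_mul, mul_one] at hpos
  linarith

/-- If finitely many operators `L i` take the family `n x` to differences of a bounded function and
one of its translates, then some convex combination of the `n x` is nearly annihilated by all of
them. -/
theorem IsAmenableGroup.exists_mem_convexHull_norm_lt {G : Type v} [Group G]
    (hG : IsAmenableGroup G) {D E : Type*} [NormedAddCommGroup D] [NormedSpace ℝ D]
    [NormedAddCommGroup E] [NormedSpace ℝ E] {ι : Type*} (T : Finset ι) (n : G → D)
    (L : ι → D →L[ℝ] E)
    (h : ∀ i ∈ T, ∃ (g : G) (u : G → E), (∃ C, ∀ x, ‖u x‖ ≤ C) ∧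
      ∀ x, L i (n x) = u (g * x) - u x) {ε : ℝ} (hε : 0 < ε) :
    ∃ d ∈ convexHull ℝ (Set.range n), ∀ i ∈ T, ‖L i d‖ < ε := by
  choose g u hu hL using fun i : T => h i i.2
  have h0 := hG.zero_mem_closure_convexHull g u hu
  let P : D →L[ℝ] (T → E) := ContinuousLinearMap.pi fun i => L i
  have e : (Set.range fun x i => u i (g i * x) - u i x) = P '' Set.range n := by
    rw [← Set.range_comp]
    congr 1
    funext x i
    exact (hL i x).symm
  have hP : P '' convexHull ℝ (Set.range n) = convexHull ℝ (P '' Set.range n) :=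
    P.toLinearMap.isLinear.image_convexHull _
  rw [e, ← hP, Metric.mem_closure_iff] at h0
  obtain ⟨_, ⟨d, hd, rfl⟩, hlt⟩ := h0 ε hε
  rw [dist_zero_left] at hlt
  exact ⟨d, hd, fun i hi => (norm_le_pi_norm (P d) ⟨i, hi⟩).trans_lt hlt⟩

/-! ### Almost diagonal tensors from a Brandt semigroup in a Banach algebra -/

namespace BrandtSemigroup

open ProjTensorSq

/-- Finitely many elements of `B(I, G)` involve only finitely many indices. -/
theorem exists_finset_indices {I : Type u} {G : Type v}
    (T : Finset (BrandtSemigroup I G)) :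
    ∃ F : Finset I, ∀ k g l, elem k g l ∈ T → k ∈ F ∧ l ∈ F := by
  classical
  refine ⟨T.biUnion fun s => match s with | null => ∅ | elem k _ l => {k, l}, fun k g l h => ?_⟩
  constructor <;> exact Finset.mem_biUnion.2 ⟨_, h, by simp⟩

variable {I : Type u} {G : Type v} [Group G] {A : Type*} [NonUnitalNormedRing A]
  (d : BrandtSemigroup I G →ₙ* A)

/-- The element `d (i, g, j) - d o` of `A`. These elements multiply like the matrix units `g E_ij`
over `G` and are annihilated by `d o`. -/
noncomputable def unit (i : I) (g : G) (j : I) : A :=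
  d (elem i g j) - d null

variable {d} in
theorem norm_unit_le (hd : ∀ s, ‖d s‖ ≤ 1) (i : I) (g : G) (j : I) : ‖unit d i g j‖ ≤ 2 :=
  (norm_sub_le _ _).trans ((add_le_add (hd _) (hd _)).trans_eq one_add_one_eq_two)

open Classical in
theorem elem_mul_unit (k l i j : I) (g h : G) :
    d (elem k g l) * unit d i h j = if l = i then unit d k (g * h) j else 0 := by
  unfold unit
  rw [mul_sub, ← map_mul, ← map_mul, elem_mul_elem, mul_null]
  split_ifs <;> simp

open Classical in
theorem unit_mul_elem (k l i j : I) (g h : G) :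
    unit d i h j * d (elem k g l) = if j = k then unit d i (h * g) l else 0 := by
  unfold unit
  rw [sub_mul, ← map_mul, ← map_mul, elem_mul_elem, null_mul]
  split_ifs <;> simp

theorem null_mul_unit (i j : I) (h : G) : d null * unit d i h j = 0 := by
  simp [unit, mul_sub, ← map_mul]

theorem unit_mul_null (i j : I) (h : G) : unit d i h j * d null = 0 := by
  simp [unit, sub_mul, ← map_mul]

open Classical in
theorem unit_mul_unit (k l i j : I) (g h : G) :
    unit d k g l * unit d i h j = if l = i then unit d k (g * h) j else 0 := by
  rw [← elem_mul_unit, unit, sub_mul, null_mul_unit, sub_zero]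

theorem null_mul_null : d null * d null = d null := by
  rw [← map_mul, null_mul]

/-- The idempotent `d o + ∑_{i ∈ F} unit i 1 i`, a left identity for the `d (k, g, l)` with
`k ∈ F`. -/
noncomputable def blockUnit (F : Finset I) : A :=
  d null + ∑ i ∈ F, unit d i 1 i

open Classical in
theorem blockUnit_mul_elem (F : Finset I) (k l : I) (g : G) :
    blockUnit d F * d (elem k g l) = if k ∈ F then d (elem k g l) else d null := by
  unfold blockUnit
  rw [add_mul, Finset.sum_mul, ← map_mul, null_mul]
  simp only [unit_mul_elem, Finset.sum_ite_eq', one_mul]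
  split_ifs <;> simp [unit]

theorem blockUnit_mul_null (F : Finset I) : blockUnit d F * d null = d null := by
  simp [blockUnit, add_mul, Finset.sum_mul, null_mul_null, unit_mul_null]

variable {d} in
theorem norm_blockUnit_mul_sub_le (hd : ∀ s, ‖d s‖ ≤ 1) (F : Finset I)
    (s : BrandtSemigroup I G) : ‖blockUnit d F * d s - d s‖ ≤ 2 := by
  classical
  have h : ‖blockUnit d F * d s‖ ≤ 1 := by
    rcases s with _ | ⟨k, g, l⟩
    · rw [blockUnit_mul_null]
      exact hd _
    · rw [blockUnit_mul_elem]
      split_ifs <;> exact hd _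
  exact (norm_sub_le _ _).trans ((add_le_add h (hd s)).trans_eq one_add_one_eq_two)

variable [NormedSpace ℂ A]

/-- The average over `j ∈ F` of the tensors `unit k x j ⊗ unit j y l`. -/
noncomputable def avgTensor (F : Finset I) (k l : I) (x y : G) : ProjTensorSq A :=
  (F.card : ℂ)⁻¹ • ∑ j ∈ F, tmul (unit d k x j) (unit d j y l)

variable {d} in
theorem norm_avgTensor_le (hd : ∀ s, ‖d s‖ ≤ 1) (F : Finset I) (k l : I) (x y : G) :
    ‖avgTensor d F k l x y‖ ≤ 4 := by
  have h : ‖∑ j ∈ F, tmul (unit d k x j) (unit d j y l)‖ ≤ F.card * 4 := by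
    rw [← nsmul_eq_mul, ← Finset.sum_const]
    refine norm_sum_le_of_le _ fun j _ => (norm_tmul_le _ _).trans ?_
    exact (mul_le_mul (norm_unit_le hd _ _ _) (norm_unit_le hd _ _ _) (norm_nonneg _)
      zero_le_two).trans_eq (by norm_num)
  unfold avgTensor
  rw [norm_smul, norm_inv, Complex.norm_natCast]
  rcases F.eq_empty_or_nonempty with rfl | hF
  · simp
  · have hc : (0 : ℝ) < F.card := by exact_mod_cast hF.card_pos
    exact (inv_mul_le_iff₀ hc).2 h

/-- The tensor `d o ⊗ d o + |F|⁻¹ ∑_{i, j ∈ F} unit i x j ⊗ unit j x⁻¹ i`: the canonical diagonal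
of the matrix block over `F`, with the group coordinate kept at the single point `x`. -/
noncomputable def blockDiag (F : Finset I) (x : G) : ProjTensorSq A :=
  tmul (d null) (d null) + ∑ i ∈ F, avgTensor d F i i x x⁻¹

variable [IsScalarTower ℂ A A] [SMulCommClass ℂ A A]

open Classical in
theorem leftAct_elem_blockDiag (F : Finset I) (k l : I) (g x : G) :
    leftAct (d (elem k g l)) (blockDiag d F x) =
      tmul (d null) (d null) + if l ∈ F then avgTensor d F k l (g * x) x⁻¹ else 0 := by
  have h : ∀ i, leftAct (d (elem k g l)) (avgTensor d F i i x x⁻¹) =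
      if l = i then avgTensor d F k l (g * x) x⁻¹ else 0 := fun i => by
    unfold avgTensor
    rw [leftAct_smul_sum_tmul]
    simp only [elem_mul_unit]
    by_cases hl : l = i
    · subst hl; simp
    · simp [hl]
  unfold blockDiag
  rw [map_add, map_sum, leftAct_tmul, ← map_mul, mul_null]
  simp [h]

open Classical in
theorem rightAct_elem_blockDiag (F : Finset I) (k l : I) (g x : G) :
    rightAct (d (elem k g l)) (blockDiag d F x) =
      tmul (d null) (d null) + if k ∈ F then avgTensor d F k l x (x⁻¹ * g) else 0 := by
  have h : ∀ i, rightAct (d (elem k g l)) (avgTensor d F i i x x⁻¹) =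
      if i = k then avgTensor d F k l x (x⁻¹ * g) else 0 := fun i => by
    unfold avgTensor
    rw [rightAct_smul_sum_tmul]
    simp only [unit_mul_elem]
    by_cases hl : i = k
    · subst hl; simp
    · simp [hl]
  unfold blockDiag
  rw [map_add, map_sum, rightAct_tmul, ← map_mul, null_mul]
  simp [h]

theorem leftAct_null_blockDiag (F : Finset I) (x : G) :
    leftAct (d null) (blockDiag d F x) = tmul (d null) (d null) := by
  have h : ∀ i, leftAct (d null) (avgTensor d F i i x x⁻¹) = 0 := fun i => by
    unfold avgTensor
    rw [leftAct_smul_sum_tmul]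
    simp [null_mul_unit]
  unfold blockDiag
  rw [map_add, map_sum, leftAct_tmul, null_mul_null]
  simp [h]

theorem rightAct_null_blockDiag (F : Finset I) (x : G) :
    rightAct (d null) (blockDiag d F x) = tmul (d null) (d null) := by
  have h : ∀ i, rightAct (d null) (avgTensor d F i i x x⁻¹) = 0 := fun i => by
    unfold avgTensor
    rw [rightAct_smul_sum_tmul]
    simp [unit_mul_null]
  unfold blockDiag
  rw [map_add, map_sum, rightAct_tmul, null_mul_null]
  simp [h]

variable {d} in
/-- The bound is independent of `F`: multiplying by `d s` on either side leaves at most one of the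
averages that make up `blockDiag d F x`. -/
theorem norm_leftAct_sub_rightAct_blockDiag_le (hd : ∀ s, ‖d s‖ ≤ 1) (F : Finset I) (x : G)
    (s : BrandtSemigroup I G) :
    ‖leftAct (d s) (blockDiag d F x) - rightAct (d s) (blockDiag d F x)‖ ≤ 8 := by
  classical
  rcases s with _ | ⟨k, g, l⟩
  · rw [leftAct_null_blockDiag, rightAct_null_blockDiag, sub_self, norm_zero]
    norm_num
  · have h : ∀ (p : Prop) [Decidable p] (y z : G),
        ‖if p then avgTensor d F k l y z else 0‖ ≤ 4 := fun p _ y z => by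
      split_ifs
      · exact norm_avgTensor_le hd _ _ _ _ _
      · simp
    rw [leftAct_elem_blockDiag, rightAct_elem_blockDiag, add_sub_add_left_eq_sub]
    exact (norm_sub_le _ _).trans ((add_le_add (h _ _ _) (h _ _ _)).trans_eq (by norm_num))

theorem diagonalMap_blockDiag [CompleteSpace A] (F : Finset I) (x : G) :
    diagonalMap (blockDiag d F x) = blockUnit d F := by
  unfold blockDiag blockUnit
  rw [map_add, map_sum, diagonalMap_tmul, null_mul_null]
  congr 1
  refine Finset.sum_congr rfl fun i hi => ?_
  have hc : (F.card : ℂ) ≠ 0 := by exact_mod_cast (Finset.card_pos.2 ⟨i, hi⟩).ne'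
  unfold avgTensor
  rw [diagonalMap_smul_sum_tmul]
  simp only [unit_mul_unit, if_true, mul_inv_cancel, Finset.sum_const]
  rw [← Nat.cast_smul_eq_nsmul ℂ, smul_smul, inv_mul_cancel₀ hc, one_smul]

variable {d} in
/-- The tensor is a convex combination of the `blockDiag d F x`, `x ∈ G`, with `F` containing all
indices that occur in `T`. The uniform bounds and the value under `π` are common to the
`blockDiag d F x` and pass to convex combinations; amenability supplies the combination that almost
commutes with `d s` for `s ∈ T`. -/
theorem exists_almost_diagonal [CompleteSpace A] (hG : IsAmenableGroup G) (hd : ∀ s, ‖d s‖ ≤ 1)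
    (T : Finset (BrandtSemigroup I G)) {ε : ℝ} (hε : 0 < ε) :
    ∃ n : ProjTensorSq A,
      (∀ s, ‖leftAct (d s) n - rightAct (d s) n‖ ≤ 8) ∧
      (∀ s, ‖diagonalMap n * d s - d s‖ ≤ 8) ∧
      (∀ s ∈ T, ‖leftAct (d s) n - rightAct (d s) n‖ < ε) ∧
      ∀ s ∈ T, diagonalMap n * d s = d s := by
  obtain ⟨F, hF⟩ := exists_finset_indices T
  let L : BrandtSemigroup I G → ProjTensorSq A →L[ℝ] ProjTensorSq A := fun s =>
    (leftAct (d s) - rightAct (d s)).restrictScalars ℝ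
  have hL : ∀ s n, L s n = leftAct (d s) n - rightAct (d s) n := fun _ _ => rfl
  obtain ⟨n, hn, hnT⟩ := hG.exists_mem_convexHull_norm_lt T (blockDiag d F) L (fun s hs => by
    rcases s with _ | ⟨k, g, l⟩
    · refine ⟨1, 0, ⟨0, by simp⟩, fun x => ?_⟩
      rw [hL, leftAct_null_blockDiag, rightAct_null_blockDiag]
      simp
    · -- The translate of `u` by `g` is `x ↦ avgTensor d F k l (g * x) x⁻¹`.
      refine ⟨g, fun x => avgTensor d F k l x (x⁻¹ * g),
        ⟨4, fun x => norm_avgTensor_le hd _ _ _ _ _⟩, fun x => ?_⟩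
      obtain ⟨hk, hl⟩ := hF k g l hs
      rw [hL, leftAct_elem_blockDiag, rightAct_elem_blockDiag, if_pos hk, if_pos hl]
      simp) hε
  have hπ : diagonalMap n = blockUnit d F := by
    refine convexHull_min (t := {n | diagonalMap n = blockUnit d F}) ?_ ?_ hn
    · rintro _ ⟨x, rfl⟩
      exact diagonalMap_blockDiag d F x
    · exact (convex_singleton _).linear_preimage
        ((diagonalMap (A := A)).restrictScalars ℝ).toLinearMap
  refine ⟨n, fun s => ?_, fun s => ?_, hnT, fun s hs => ?_⟩
  · have hconv := (convex_closedBall (0 : ProjTensorSq A) 8).linear_preimage (L s).toLinearMap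
    refine mem_closedBall_zero_iff.1 (convexHull_min ?_ hconv hn)
    rintro _ ⟨x, rfl⟩
    exact mem_closedBall_zero_iff.2 (norm_leftAct_sub_rightAct_blockDiag_le hd F x s)
  · rw [hπ]
    exact (norm_blockUnit_mul_sub_le hd F s).trans (by norm_num)
  · rw [hπ]
    rcases s with _ | ⟨k, g, l⟩
    · exact blockUnit_mul_null d F
    · rw [blockUnit_mul_elem, if_pos (hF k g l hs).1]

end BrandtSemigroup

theorem mainTheorem1 (I : Type u) [Nonempty I] (G : Type v) [Group G] (hG : IsAmenableGroup G) :
    IsPseudoAmenable (L1Algebra (BrandtSemigroup I G)) :=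
  L1Algebra.isPseudoAmenable_of_delta 8 fun T _ hε =>
    BrandtSemigroup.exists_almost_diagonal (d := L1Algebra.deltaHom (BrandtSemigroup I G)) hG
      (fun s => (L1Algebra.norm_delta s).le) T hε
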